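/- For a monoid $M$, let $\operatorname{rank} M$ denote the least cardinality of a subset of $M$ that generates $M$ as a monoid (the empty word represents the identity). Let $X$ be a finite set with $|X|\ge 3$, and let $\mathcal P$ be a partition of $X$ into non-empty blocks that is uniform (all blocks have the same cardinality) and non-trivial (the number of blocks is neither $1$ nor $|X|$). Write $x\sim_{\mathcal P}y$ if $x$ and $y$ lie in the same block of $\mathcal P$. Let $T(X)$ be the monoid of all transformations of $X$ under composition, and define the submonoids $$T(X,\mathcal P)=\{f\in T(X) : \text{for every } P\in\mathcal P \text{ there is } Q\in\mathcal P \text{ with } f(P)\subseteq Q\},$$ $$\Sigma(X,\mathcal P)=\{f\in T(X) : \text{for all } x,y\in X,\ x\sim_{\mathcal P}y \text{ if and only if } f(x)\sim_{\mathcal P}f(y)\},$$ $$\Gamma(X,\mathcal P)=\{f\in T(X,\mathcal P) : \text{for all } P,Q\in\mathcal P,\ f(P)\cap Q=\emptyset \text{ or } f(P)=Q\}.$$ Then $\operatorname{rank} T(X,\mathcal P)=4$ and $\operatorname{rank}\Sigma(X,\mathcal P)=\operatorname{rank}\Gamma(X,\mathcal P)=3$. -/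

import Mathlib

/-- The rank of a (finitely generated) monoid: the least cardinality of a set that generates it as
a monoid, the empty word representing the identity. -/
noncomputable def monoidRank (M : Type*) [Monoid M] : ℕ :=
  sInf {k : ℕ | ∃ U : Finset M, U.card = k ∧ Submonoid.closure (U : Set M) = ⊤}

/-- A family of subsets is uniform if all its members have the same cardinality. -/
def IsUniformFamily {X : Type*} (P : Set (Set X)) : Prop :=
  ∀ B ∈ P, ∀ C ∈ P, B.ncard = C.ncard

/-- A partition `P` of a finite set `X` is non-trivial if it has neither `1` nor `|X|` parts. -/
def IsNontrivialFamily {X : Type*} (P : Set (Set X)) : Prop :=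
  P.ncard ≠ 1 ∧ P.ncard ≠ Nat.card X

/-- The relation of lying in a common block of `P`. -/
def SameBlock {X : Type*} (P : Set (Set X)) (x y : X) : Prop :=
  ∃ B ∈ P, x ∈ B ∧ y ∈ B

/-- `T(X,P)`: the transformations of `X` that map every block of `P` into a block of `P`. -/
def transPreserving {X : Type*} (P : Set (Set X)) : Submonoid (Function.End X) where
  carrier := {f | ∀ B ∈ P, ∃ C ∈ P, (f : X → X) '' B ⊆ C}
  one_mem' := fun B hB => ⟨B, hB, (Set.image_id B).subset⟩
  mul_mem' := by
    intro f g hf hg B hB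
    obtain ⟨C, hC, hBC⟩ := hg B hB
    obtain ⟨D, hD, hCD⟩ := hf C hC
    refine ⟨D, hD, ?_⟩
    rintro _ ⟨x, hx, rfl⟩
    exact hCD ⟨g x, hBC ⟨x, hx, rfl⟩, rfl⟩

/-- `Σ(X,P)`: the transformations `f` such that `x`, `y` lie in a common block if and only if
`f x`, `f y` do. -/
def sigmaMonoid {X : Type*} (P : Set (Set X)) : Submonoid (Function.End X) where
  carrier := {f | ∀ x y : X, SameBlock P x y ↔ SameBlock P (f x) (f y)}
  one_mem' := fun _ _ => Iff.rfl
  mul_mem' := fun {_ g} hf hg x y => (hg x y).trans (hf (g x) (g y))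

/-- `Γ(X,P)`: the transformations in `T(X,P)` such that the image of every block is, for each
block, either disjoint from it or equal to it. -/
def gammaMonoid {X : Type*} (P : Set (Set X)) (hP : Setoid.IsPartition P) :
    Submonoid (Function.End X) where
  carrier := {f | f ∈ transPreserving P ∧
    ∀ B ∈ P, ∀ C ∈ P, (f : X → X) '' B ∩ C = ∅ ∨ (f : X → X) '' B = C}
  one_mem' := by
    refine ⟨one_mem _, fun B hB C hC => ?_⟩
    have h1 : ((1 : Function.End X) : X → X) '' B = B := Set.image_id B
    rw [h1]
    rcases eq_or_ne B C with h | h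
    · exact Or.inr h
    · exact Or.inl (Set.disjoint_iff_inter_eq_empty.mp (hP.pairwiseDisjoint hB hC h))
  mul_mem' := by
    rintro f g ⟨hf, hf'⟩ ⟨hg, hg'⟩
    refine ⟨mul_mem hf hg, fun B hB C hC => ?_⟩
    obtain ⟨D, hD, hBD⟩ := hg B hB
    obtain ⟨x, hx⟩ := Setoid.nonempty_of_mem_partition hP hB
    have h2 : (g : X → X) '' B = D := by
      rcases hg' B hB D hD with h | h
      · have hmem : g x ∈ (g : X → X) '' B ∩ D := ⟨⟨x, hx, rfl⟩, hBD ⟨x, hx, rfl⟩⟩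
        rw [h] at hmem
        exact hmem.elim
      · exact h
    have h3 : ((f * g : Function.End X) : X → X) '' B = (f : X → X) '' D := by
      rw [← h2]
      exact Set.image_comp f g B
    rw [h3]
    exact hf' D hD C hC

open Equiv

/-! ### Two generators for symmetric groups -/

/-! By `exists_equiv_prod`, `X` becomes a product of `m + 2` blocks with `n + 2` points each. Then
`T`, `Σ` and `Γ` are the maps preserving the fibres of the first projection, those that also
separate them, and those that also are injective on each.

Upper bounds: a fibre-preserving map factors as `topEnd g * baseEnd F`. The permutations among such
maps form a wreath product of symmetric groups, generated by two elements
(`exists_wreath_generators`). Adding a collapse inside one block produces all `F`, and adding a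
collapse of one block onto another produces all `g`. `Σ` needs only the first, since there `g` is
bijective; `Γ` only the second, since there every `F b` is; `T` needs both.

Lower bounds: on a finite set a product is injective only if both factors are, so the
non-commutative wreath product requires two injective generators (`two_le_card_filter_injective`). A
similar divisibility argument inside `T` forces a non-injective generator in `Σ` and one in `Γ`. For
`T` these two differ, because maps in both `Σ` and `Γ` are injective. -/

theorem swap_apply_mem {α : Type*} [DecidableEq α] {H : Subgroup (Perm α)} {g : Perm α}
    (hg : g ∈ H) {a b : α} (h : swap a b ∈ H) : swap (g a) (g b) ∈ H := by
  rw [swap_apply_apply]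
  exact H.mul_mem (H.mul_mem hg h) (H.inv_mem hg)

/-- Conjugating one transposition through `c` by another yields every transposition. -/
theorem eq_top_of_swap_mem {α : Type*} [DecidableEq α] [Finite α] {H : Subgroup (Perm α)} (c : α)
    (h : ∀ b, swap c b ∈ H) : H = ⊤ := by
  rw [eq_top_iff, ← Perm.closure_isSwap, Subgroup.closure_le]
  rintro _ ⟨a, b, hab, rfl⟩
  by_cases hca : c = a
  · exact hca ▸ h b
  · have := swap_apply_mem (h a) (h b)
    by_cases hcb : c = b
    · rw [swap_comm]; exact hcb ▸ h a
    · rwa [swap_apply_left, swap_apply_of_ne_of_ne (Ne.symm hcb) (Ne.symm hab)] at this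

theorem finRotate_pow_self (n : ℕ) : finRotate n ^ n = 1 := by
  rcases n with _ | _ | n
  · rfl
  · rw [finRotate_one]; exact one_pow _
  · have h := (isCycle_finRotate (n := n)).orderOf
    rw [support_finRotate, Finset.card_univ, Fintype.card_fin] at h
    simpa only [h] using pow_orderOf_eq_one (finRotate (n + 2))

/-- The symmetric group on at least two points is generated by a transposition and an element of
odd order. -/
theorem exists_swap_odd_closure_eq_top (n : ℕ) :
    ∃ (s p : Perm (Fin (n + 2))) (N : ℕ), s ^ 2 = 1 ∧ Odd N ∧ p ^ N = 1 ∧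
      Subgroup.closure {s, p} = ⊤ := by
  -- The cycle must have odd length: for even degree it omits the point `0`, for odd degree it is
  -- the full rotation.
  rcases Nat.even_or_odd n with hn | hn
  · let ι : Fin (n + 1) ↪ Fin (n + 2) := Fin.succEmb (n + 1)
    refine ⟨swap 0 1, Perm.viaEmbeddingHom ι (finRotate (n + 1)), n + 1, ?_, hn.add_one, ?_, ?_⟩
    · rw [sq, swap_mul_self]
    · rw [← map_pow, finRotate_pow_self, map_one]
    · set p := Perm.viaEmbeddingHom ι (finRotate (n + 1)) with hp
      have hp0 : p 0 = 0 := by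
        rw [hp, Perm.viaEmbeddingHom_apply]
        apply Perm.viaEmbedding_apply_of_notMem
        rintro ⟨x, hx⟩
        exact Fin.succ_ne_zero x hx
      have hps (i : Fin (n + 1)) : p i.succ = (i + 1).succ := by
        rw [hp, Perm.viaEmbeddingHom_apply, ← finRotate_apply]
        exact Perm.viaEmbedding_apply (finRotate (n + 1)) ι i
      have hsm : swap 0 1 ∈ Subgroup.closure {swap 0 1, p} := Subgroup.subset_closure (by simp)
      have hpm : p ∈ Subgroup.closure {swap 0 1, p} := Subgroup.subset_closure (by simp)
      refine eq_top_of_swap_mem 0 fun b => ?_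
      refine Fin.cases (by rw [swap_self]; exact one_mem _) (fun i => ?_) b
      induction i using Fin.induction with
      | zero => exact hsm
      | succ i ih =>
        have := swap_apply_mem hpm ih
        rwa [hp0, hps, Fin.coeSucc_eq_succ] at this
  · refine ⟨swap 0 (finRotate (n + 2) 0), finRotate (n + 2), n + 2, ?_, ?_,
      finRotate_pow_self _, ?_⟩
    · rw [sq, swap_mul_self]
    · obtain ⟨k, rfl⟩ := hn
      exact ⟨k + 1, by ring⟩
    · rw [Set.pair_comm]
      exact Perm.closure_cycle_adjacent_swap isCycle_finRotate support_finRotate 0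

/-! ### Wreath products acting on a product of two types -/

section Wreath

variable {β α : Type*}

/-- The permutation of `β × α` acting by a permutation on the first coordinate. -/
def topPerm : Perm β →* Perm (β × α) where
  toFun σ := prodCongr σ 1
  map_one' := rfl
  map_mul' _ _ := rfl

/-- The permutation of `β × α` acting on each fibre of the first projection by a permutation. -/
def basePerm : (β → Perm α) →* Perm (β × α) where
  toFun F := prodCongrRight F
  map_one' := rfl
  map_mul' _ _ := rfl

@[simp] theorem topPerm_apply (σ : Perm β) (x : β × α) : topPerm σ x = (σ x.1, x.2) := rfl

@[simp] theorem basePerm_apply (F : β → Perm α) (x : β × α) :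
    basePerm F x = (x.1, F x.1 x.2) := rfl

theorem topPerm_mul_basePerm (σ : Perm β) (F : β → Perm α) :
    topPerm σ * basePerm F = basePerm (F ∘ σ.symm) * topPerm σ := by
  ext x <;> simp

variable [DecidableEq β]

theorem topPerm_mul_mulSingle (σ : Perm β) (b : β) (g : Perm α) :
    topPerm σ * basePerm (Pi.mulSingle b g) =
      basePerm (Pi.mulSingle (σ b) g) * topPerm σ := by
  rw [topPerm_mul_basePerm]
  congr 2
  ext c : 1
  simp only [Function.comp_apply, Pi.mulSingle_apply, symm_apply_eq]

theorem basePerm_mulSingle_commute_topPerm {σ : Perm β} {b : β} (h : σ b = b) (g : Perm α) :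
    Commute (basePerm (Pi.mulSingle b g)) (topPerm σ) := by
  have := topPerm_mul_mulSingle σ b g
  rw [h] at this
  exact this.symm

theorem basePerm_mulSingle_mem {H : Subgroup (Perm (β × α))} (htop : ∀ σ, topPerm σ ∈ H)
    {b : β} {g : Perm α} (h : basePerm (Pi.mulSingle b g) ∈ H) (c : β) :
    basePerm (Pi.mulSingle c g) ∈ H := by
  have := topPerm_mul_mulSingle (swap b c) b g
  rw [swap_apply_left, ← mul_inv_eq_iff_eq_mul] at this
  rw [← this]
  exact mul_mem (mul_mem (htop _) h) (inv_mem (htop _))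

/-- Block permutations carry single-block elements to any block by conjugation, so `s` and `p` may
be supplied on different blocks. -/
theorem basePerm_mem {H : Subgroup (Perm (β × α))} (htop : ∀ σ, topPerm σ ∈ H)
    {b c : β} {s p : Perm α} (hsp : Subgroup.closure {s, p} = ⊤)
    (hs : basePerm (Pi.mulSingle b s) ∈ H) (hp : basePerm (Pi.mulSingle c p) ∈ H)
    (d : β) (g : Perm α) : basePerm (Pi.mulSingle d g) ∈ H := by
  have hle : Subgroup.closure {s, p} ≤
      H.comap (basePerm.comp (MonoidHom.mulSingle (fun _ : β => Perm α) d)) := by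
    rw [Subgroup.closure_le, Set.insert_subset_iff, Set.singleton_subset_iff]
    exact ⟨basePerm_mulSingle_mem htop hs d, basePerm_mulSingle_mem htop hp d⟩
  exact hle (hsp ▸ Subgroup.mem_top g)

end Wreath

theorem topPerm_mem_of_adjacent {α : Type*} {n : ℕ} {H : Subgroup (Perm (Fin (n + 1) × α))}
    (h : ∀ i : Fin n, topPerm (swap i.castSucc i.succ) ∈ H) (σ : Perm (Fin (n + 1))) :
    topPerm σ ∈ H := by
  have hle : Submonoid.closure (Set.range fun i : Fin n => swap i.castSucc i.succ) ≤
      H.toSubmonoid.comap topPerm := by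
    rw [Submonoid.closure_le]
    rintro _ ⟨i, rfl⟩
    exact h i
  rw [Perm.mclosure_swap_castSucc_succ] at hle
  exact hle (Submonoid.mem_top σ)

/-- The wreath product of two non-trivial finite symmetric groups, in its imprimitive action, is
generated by two elements. -/
theorem exists_wreath_generators (m n : ℕ) :
    ∃ x y : Perm (Fin (m + 2) × Fin (n + 2)),
      (∀ z ∈ ({x, y} : Set (Perm (Fin (m + 2) × Fin (n + 2)))), ∀ u v,
        (z u).1 = (z v).1 ↔ u.1 = v.1) ∧
      (∀ σ, topPerm σ ∈ Subgroup.closure {x, y}) ∧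
      ∀ b g, basePerm (Pi.mulSingle b g) ∈ Subgroup.closure {x, y} := by
  obtain ⟨s, p, N, hs, hN, hp, hsp⟩ := exists_swap_odd_closure_eq_top n
  obtain ⟨k, rfl⟩ := hN
  have hs' : s ^ (2 * k) = 1 := by rw [pow_mul, hs, one_pow]
  -- With two blocks, no third block is left fixed by the swap to carry `p`, so the generators are
  -- chosen differently. In both cases an odd power kills `p` and keeps an involution.
  rcases m with _ | m
  · set x : Perm (Fin 2 × Fin (n + 2)) :=
      basePerm (Pi.mulSingle 0 p) * basePerm (Pi.mulSingle 1 s) with hx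
    set y : Perm (Fin 2 × Fin (n + 2)) := topPerm (swap 0 1) with hy
    have hxm : x ∈ Subgroup.closure {x, y} := Subgroup.subset_closure (by simp)
    have hym : y ∈ Subgroup.closure {x, y} := Subgroup.subset_closure (by simp)
    have htop : ∀ σ, topPerm σ ∈ Subgroup.closure {x, y} := by
      refine topPerm_mem_of_adjacent fun i => ?_
      have : i = 0 := Subsingleton.elim _ _
      subst this
      exact hym
    have hcomm : Commute (basePerm (Pi.mulSingle (0 : Fin 2) p))
        (basePerm (Pi.mulSingle (1 : Fin 2) s)) :=
      (Pi.mulSingle_commute (f := fun _ : Fin 2 => Perm (Fin (n + 2))) zero_ne_one p s).map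
        basePerm
    have h1 : basePerm (Pi.mulSingle (1 : Fin 2) s) ∈ Subgroup.closure {x, y} := by
      have : x ^ (2 * k + 1) = basePerm (Pi.mulSingle (1 : Fin 2) s) := by
        rw [hx, hcomm.mul_pow, ← map_pow, ← map_pow, ← Pi.mulSingle_pow, ← Pi.mulSingle_pow, hp,
          pow_succ s, hs', one_mul, Pi.mulSingle_one, map_one, one_mul]
      exact this ▸ pow_mem hxm _
    have h0 : basePerm (Pi.mulSingle (0 : Fin 2) p) ∈ Subgroup.closure {x, y} := by
      rwa [hx, ← Subgroup.mul_mem_cancel_right _ h1, ← hx]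
    refine ⟨x, y, ?_, htop, basePerm_mem htop hsp h1 h0⟩
    rintro z (rfl | rfl) u v
    · simp [hx]
    · simp [hy]
  · set x : Perm (Fin (m + 3) × Fin (n + 2)) :=
      basePerm (Pi.mulSingle 0 s) * topPerm (finRotate (m + 3)) with hx
    set y : Perm (Fin (m + 3) × Fin (n + 2)) :=
      basePerm (Pi.mulSingle 2 p) * topPerm (swap 0 1) with hy
    have hxm : x ∈ Subgroup.closure {x, y} := Subgroup.subset_closure (by simp)
    have hym : y ∈ Subgroup.closure {x, y} := Subgroup.subset_closure (by simp)
    have hmod : 2 % (m + 3) = 2 := Nat.mod_eq_of_lt (by omega)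
    have hfix : swap (0 : Fin (m + 3)) 1 2 = 2 :=
      swap_apply_of_ne_of_ne (by simp [Fin.ext_iff, hmod]) (by simp [Fin.ext_iff, hmod])
    have ht : topPerm (swap 0 1) ∈ Subgroup.closure {x, y} := by
      have : y ^ (2 * k + 1) = topPerm (swap 0 1) := by
        rw [hy, (basePerm_mulSingle_commute_topPerm hfix p).mul_pow, ← map_pow, ← map_pow,
          ← Pi.mulSingle_pow, hp, Pi.mulSingle_one, map_one, one_mul, pow_succ, pow_mul, sq,
          swap_mul_self, one_pow, one_mul]
      exact this ▸ pow_mem hym _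
    have htop : ∀ σ, topPerm σ ∈ Subgroup.closure {x, y} := by
      refine topPerm_mem_of_adjacent fun i => ?_
      induction i using Fin.induction with
      | zero => exact ht
      | succ i ih =>
        set r : Perm (Fin (m + 3)) := finRotate (m + 3) with hr
        have hr1 : r i.castSucc.castSucc = i.succ.castSucc := by
          rw [hr, finRotate_apply, Fin.coeSucc_eq_succ, Fin.succ_castSucc]
        have hr2 : r i.castSucc.succ = i.succ.succ := by
          rw [hr, finRotate_apply, Fin.succ_castSucc, Fin.coeSucc_eq_succ]
        have h0 : swap i.succ.castSucc i.succ.succ (0 : Fin (m + 3)) = 0 :=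
          swap_apply_of_ne_of_ne (Fin.succ_ne_zero i.castSucc).symm (Fin.succ_ne_zero i.succ).symm
        -- The shifted transposition fixes block `0`, so the factor `s` there commutes with it and
        -- conjugation by `x` acts as the pure rotation.
        have : topPerm (swap i.succ.castSucc i.succ.succ) =
            x * topPerm (swap i.castSucc.castSucc i.castSucc.succ) * x⁻¹ := by
          rw [eq_mul_inv_iff_mul_eq, hx, mul_assoc, ← map_mul, ← mul_assoc,
            ← (basePerm_mulSingle_commute_topPerm h0 s).eq, mul_assoc, ← map_mul, ← hr1, ← hr2,
            swap_apply_apply, inv_mul_cancel_right]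
        rw [this]
        exact mul_mem (mul_mem hxm ih) (inv_mem hxm)
    have h0 : basePerm (Pi.mulSingle (0 : Fin (m + 3)) s) ∈ Subgroup.closure {x, y} := by
      rwa [← Subgroup.mul_mem_cancel_right _ (htop (finRotate (m + 3))), ← hx]
    have h2 : basePerm (Pi.mulSingle (2 : Fin (m + 3)) p) ∈ Subgroup.closure {x, y} := by
      rwa [← Subgroup.mul_mem_cancel_right _ ht, ← hy]
    refine ⟨x, y, ?_, htop, basePerm_mem htop hsp h0 h2⟩
    rintro z (rfl | rfl) u v
    · simp [hx]
    · simp [hy]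

/-! ### Ranks -/

theorem monoidRank_eq_of_injective {M N : Type*} [Monoid M] [Monoid N] (j : M →* N)
    (hj : Function.Injective j) {k : ℕ}
    (hU : ∃ U : Finset N, U.card ≤ k ∧ Submonoid.closure (U : Set N) = MonoidHom.mrange j)
    (hle : ∀ U : Finset N, Submonoid.closure (U : Set N) = MonoidHom.mrange j → k ≤ U.card) :
    monoidRank M = k := by
  classical
  have hlow : ∀ V : Finset M, Submonoid.closure (V : Set M) = ⊤ → k ≤ V.card := by
    intro V hV
    refine (hle (V.image j) ?_).trans Finset.card_image_le
    rw [Finset.coe_image, ← MonoidHom.map_mclosure, hV, MonoidHom.mrange_eq_map]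
  obtain ⟨U, hUk, hU⟩ := hU
  let V : Finset M := U.preimage j hj.injOn
  have hV : Submonoid.closure (V : Set M) = ⊤ := by
    apply Submonoid.map_injective_of_injective (f := j) hj
    rw [MonoidHom.map_mclosure, ← MonoidHom.mrange_eq_map, ← hU, Finset.coe_preimage,
      Set.image_preimage_eq_of_subset]
    intro u hu
    have : u ∈ MonoidHom.mrange j := hU ▸ Submonoid.subset_closure hu
    exact this
  have hVk : V.card ≤ k :=
    (Finset.card_le_card_of_injOn j (fun v hv => by simpa [V] using hv) hj.injOn).trans hUk
  have hmem : V.card ∈ {k : ℕ | ∃ U : Finset M, U.card = k ∧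
      Submonoid.closure (U : Set M) = ⊤} := ⟨V, rfl, hV⟩
  refine le_antisymm ((Nat.sInf_le hmem).trans hVk) (le_csInf ⟨_, hmem⟩ ?_)
  rintro _ ⟨W, rfl, hW⟩
  exact hlow W hW

/-- Conjugation by a bijection, as a homomorphism of full transformation monoids. -/
def conjEnd {X Y : Type*} (e : X ≃ Y) : Function.End X →* Function.End Y where
  toFun f := fun y => e (f (e.symm y))
  map_one' := funext fun y => e.apply_symm_apply y
  map_mul' f g := funext fun y => by
    change e (f (g (e.symm y))) = e (f (e.symm (e (g (e.symm y)))))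
    rw [e.symm_apply_apply]

theorem conjEnd_apply {X Y : Type*} (e : X ≃ Y) (f : Function.End X) (y : Y) :
    conjEnd e f y = e (f (e.symm y)) := rfl

theorem monoidRank_submonoid_eq {X Y : Type*} (e : X ≃ Y) {S : Submonoid (Function.End X)}
    {S' : Submonoid (Function.End Y)} (hS : ∀ f, f ∈ S ↔ conjEnd e f ∈ S') {k : ℕ}
    (hU : ∃ U : Finset (Function.End Y), U.card ≤ k ∧
      Submonoid.closure (U : Set (Function.End Y)) = S')
    (hle : ∀ U : Finset (Function.End Y),
      Submonoid.closure (U : Set (Function.End Y)) = S' → k ≤ U.card) :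
    monoidRank S = k := by
  have hrange : MonoidHom.mrange ((conjEnd e).comp S.subtype) = S' := by
    ext g
    constructor
    · rintro ⟨f, rfl⟩
      exact (hS f).1 f.2
    · intro hg
      have hg' : conjEnd e (conjEnd e.symm g) = g :=
        funext fun y => by simp [conjEnd_apply]
      exact ⟨⟨conjEnd e.symm g, (hS _).2 (hg'.symm ▸ hg)⟩, hg'⟩
  refine monoidRank_eq_of_injective ((conjEnd e).comp S.subtype) ?_ (hrange.symm ▸ hU)
    (hrange.symm ▸ hle)
  refine fun f g hfg => Subtype.ext (funext fun x => ?_)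
  have := congrFun hfg (e x)
  simpa [conjEnd_apply] using this

/-! ### Transformations of finite sets -/

/-- The inclusion of the symmetric group in the full transformation monoid. -/
def permEnd {Y : Type*} : Perm Y →* Function.End Y where
  toFun σ := fun y => σ y
  map_one' := rfl
  map_mul' _ _ := rfl

theorem exists_permEnd_eq {Y : Type*} [Finite Y] {f : Function.End Y}
    (hf : Function.Injective f) : ∃ σ : Perm Y, permEnd σ = f :=
  ⟨Equiv.ofBijective f (Finite.injective_iff_bijective.1 hf), rfl⟩

/-- In a finite group inverses are positive powers, so group generators are also monoid generators.
-/
theorem permEnd_mem_closure {Y : Type*} [Finite Y] {x y σ : Perm Y}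
    (hσ : σ ∈ Subgroup.closure {x, y}) {S : Submonoid (Function.End Y)} (hx : permEnd x ∈ S)
    (hy : permEnd y ∈ S) : permEnd σ ∈ S := by
  rw [← Subgroup.mem_toSubmonoid, Subgroup.closure_toSubmonoid_of_finite] at hσ
  have hle : Submonoid.closure {x, y} ≤ S.comap permEnd := by
    rw [Submonoid.closure_le, Set.insert_subset_iff, Set.singleton_subset_iff]
    exact ⟨hx, hy⟩
  exact hle hσ

/-- The idempotent transformation moving `a` to `b` and fixing everything else. -/
def collapse {Y : Type*} [DecidableEq Y] (a b : Y) : Function.End Y :=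
  fun y => if y = a then b else y

theorem collapse_not_injective {Y : Type*} [DecidableEq Y] {a b : Y} (hab : a ≠ b) :
    ¬ Function.Injective (collapse a b) := fun h =>
  hab (h (by simp [collapse, hab.symm]))

/-- The full transformation monoid of a finite set is generated by its units and one idempotent
of defect one. -/
theorem eq_top_of_permEnd_mem {Y : Type*} [Finite Y] [DecidableEq Y]
    {S : Submonoid (Function.End Y)} (hperm : ∀ σ, permEnd σ ∈ S) {a b : Y} (hab : a ≠ b)
    (hc : collapse a b ∈ S) : S = ⊤ := by
  have hcol : ∀ c d, c ≠ d → collapse c d ∈ S := by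
    intro c d hcd
    obtain ⟨σ, hσa, hσb⟩ : ∃ σ : Perm Y, σ a = c ∧ σ b = d := by
      refine ⟨swap (swap a c b) d * swap a c, ?_, by simp⟩
      have : c ≠ swap a c b := by
        intro h
        rw [eq_comm, swap_apply_eq_iff, swap_apply_right] at h
        exact hab h.symm
      simp [swap_apply_of_ne_of_ne this hcd]
    have : collapse c d = permEnd σ * collapse a b * permEnd σ⁻¹ := by
      funext y
      change (if y = c then d else y) = σ (if σ.symm y = a then b else σ.symm y)
      simp only [symm_apply_eq, hσa]
      split_ifs
      · exact hσb.symm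
      · simp
    rw [this]
    exact mul_mem (mul_mem (hperm _) hc) (hperm _)
  -- Induction on the defect, the number of points missed by the image.
  have key : ∀ (k : ℕ) (f : Y → Y), (Set.range f)ᶜ.ncard = k → f ∈ S := by
    intro k
    induction k with
    | zero =>
      intro f hf
      rw [Set.ncard_eq_zero, Set.compl_empty_iff, Set.range_eq_univ] at hf
      obtain ⟨σ, hσ⟩ := exists_permEnd_eq (f := f) (Finite.injective_iff_surjective.2 hf)
      exact hσ ▸ hperm σ
    | succ k ih =>
      intro f hf
      obtain ⟨z, hz⟩ : (Set.range f)ᶜ.Nonempty := by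
        rw [← Set.ncard_pos]; omega
      have hni : ¬ Function.Injective f := fun h =>
        hz (Set.range_eq_univ.2 (Finite.injective_iff_surjective.1 h) ▸ Set.mem_univ z)
      obtain ⟨c, d, hfcd, hcd⟩ : ∃ c d, f c = f d ∧ c ≠ d := by
        simpa [Function.Injective] using hni
      -- As `f c = f d`, the value at `c` can be redirected to the missed point `z`: the image gains
      -- `z`, and precomposing with the collapse of `c` to `d` recovers `f`.
      let g : Y → Y := Function.update f c z
      let g' : Function.End Y := g
      have hfg : g' * collapse c d = f := by
        funext y
        change Function.update f c z (if y = c then d else y) = f y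
        by_cases hy : y = c
        · simp [hy, hcd.symm, hfcd]
        · simp [hy]
      have hg : (Set.range g)ᶜ = (Set.range f)ᶜ \ {z} := by
        ext w
        simp only [Set.mem_compl_iff, Set.mem_range, Set.mem_sdiff, Set.mem_singleton_iff,
          not_exists]
        constructor
        · intro h
          refine ⟨fun y hy => ?_, fun hw => h c (by simp [g, hw])⟩
          by_cases hyc : y = c
          · exact h d (by rw [← hy, hyc, hfcd]; exact Function.update_of_ne hcd.symm _ _)
          · exact h y (by simp [g, hyc, hy])
        · rintro ⟨h, hw⟩ y hy
          by_cases hyc : y = c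
          · exact hw (by simpa [g, hyc] using hy.symm)
          · exact h y (by simpa [g, hyc] using hy)
      have hgS : g ∈ S := by
        refine ih g ?_
        rw [hg, Set.ncard_sdiff_singleton_of_mem hz, hf, Nat.add_sub_cancel]
      exact hfg ▸ mul_mem (a := g') hgS (hcol c d hcd)
  exact eq_top_iff.2 fun f _ => key _ f rfl

theorem injective_mul_iff {Y : Type*} [Finite Y] {f g : Function.End Y} :
    Function.Injective (f * g : Function.End Y) ↔ Function.Injective f ∧ Function.Injective g := by
  constructor
  · intro h
    have hg : Function.Injective g := Function.Injective.of_comp (f := f) h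
    refine ⟨?_, hg⟩
    have hs : Function.Surjective (f ∘ g) := Finite.injective_iff_surjective.1 h
    exact Finite.injective_iff_surjective.2 hs.of_comp
  · rintro ⟨hf, hg⟩
    exact hf.comp hg

/-- The injective transformations of a set. -/
def injectiveEnd (Y : Type*) : Set (Function.End Y) := {f | Function.Injective f}

/-- A set of transformations generating two non-commuting permutations contains at least two
permutations. -/
theorem two_le_card_filter_injective {Y : Type*} [Finite Y] [DecidablePred (· ∈ injectiveEnd Y)]
    {U : Finset (Function.End Y)} {u v : Function.End Y}
    (hu : u ∈ Submonoid.closure (U : Set (Function.End Y))) (hui : Function.Injective u)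
    (hv : v ∈ Submonoid.closure (U : Set (Function.End Y))) (hvi : Function.Injective v)
    (huv : u * v ≠ v * u) : 2 ≤ (U.filter (· ∈ injectiveEnd _)).card := by
  by_contra! hlt
  set J := U.filter (· ∈ injectiveEnd _) with hJ
  have hclos : ∀ f ∈ Submonoid.closure (U : Set (Function.End Y)), Function.Injective f →
      f ∈ Submonoid.closure (J : Set (Function.End Y)) := by
    intro f hf
    induction hf using Submonoid.closure_induction with
    | mem f hf =>
      intro hfi
      exact Submonoid.subset_closure (Finset.mem_coe.2 (Finset.mem_filter.2 ⟨hf, hfi⟩))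
    | one => exact fun _ => one_mem _
    | mul f g _ _ ihf ihg =>
      intro hfg
      obtain ⟨hfi, hgi⟩ := injective_mul_iff.1 hfg
      exact mul_mem (ihf hfi) (ihg hgi)
  have hcomm : ∀ f ∈ (J : Set (Function.End Y)), ∀ g ∈ (J : Set (Function.End Y)),
      f * g = g * f := by
    intro f hf g hg
    rw [Finset.card_le_one.1 (Nat.lt_succ_iff.1 hlt) f hf g hg]
  -- At most one generator is injective, so the submonoid generated by `J` is commutative.
  have hle := Submonoid.closure_le_centralizer_centralizer (J : Set (Function.End Y))
  have hv' : v ∈ Submonoid.centralizer (J : Set (Function.End Y)) := by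
    have : (J : Set (Function.End Y)) ⊆ Submonoid.centralizer (J : Set (Function.End Y)) :=
      fun f hf => Submonoid.mem_centralizer_iff.2 fun g hg => hcomm g hg f hf
    exact (Submonoid.closure_le.2 this) (hclos v hv hvi)
  have hu' := Submonoid.mem_centralizer_iff.1 (hle (hclos u hu hui)) v hv'
  exact huv hu'.symm

/-! ### Transformations respecting the fibres of a product -/

section Fibres

variable (β α : Type*)

/-- The transformations mapping each fibre of the first projection into a fibre. -/
def fibreMonoid : Submonoid (Function.End (β × α)) where
  carrier := {f | ∀ x y : β × α, x.1 = y.1 → (f x).1 = (f y).1}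
  one_mem' := fun _ _ h => h
  mul_mem' := fun {_ g} hf hg x y h => hf (g x) (g y) (hg x y h)

/-- The transformations mapping distinct fibres of the first projection into distinct fibres. -/
def fibreSeparatingMonoid : Submonoid (Function.End (β × α)) where
  carrier := {f | ∀ x y : β × α, x.1 = y.1 ↔ (f x).1 = (f y).1}
  one_mem' := fun _ _ => Iff.rfl
  mul_mem' := fun {_ g} hf hg x y => (hg x y).trans (hf (g x) (g y))

/-- The transformations mapping each fibre of the first projection injectively into a fibre. -/
def fibreInjectiveMonoid : Submonoid (Function.End (β × α)) where
  carrier := {f | f ∈ fibreMonoid β α ∧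
    ∀ x y : β × α, x.1 = y.1 → f x = f y → x = y}
  one_mem' := ⟨one_mem _, fun _ _ _ h => h⟩
  mul_mem' := fun {_ g} hf hg => ⟨mul_mem hf.1 hg.1, fun x y h hxy =>
    hg.2 x y h (hf.2 (g x) (g y) (hg.1 x y h) hxy)⟩

variable {β α}

theorem mem_fibreMonoid_of_separating {f : Function.End (β × α)}
    (hf : f ∈ fibreSeparatingMonoid β α) : f ∈ fibreMonoid β α := fun x y => (hf x y).1

theorem injective_of_separating_of_fibreInjective {f : Function.End (β × α)}
    (hf : f ∈ fibreSeparatingMonoid β α) (hf' : f ∈ fibreInjectiveMonoid β α) :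
    Function.Injective f := fun x y hxy =>
  hf'.2 x y ((hf x y).2 (congrArg Prod.fst hxy)) hxy

/-- The map induced on the finite set of fibres is surjective, hence injective. -/
theorem fibreSeparating_of_injective [Finite β] [Finite α] {f : Function.End (β × α)}
    (hf : f ∈ fibreMonoid β α) (hfi : Function.Injective f) : f ∈ fibreSeparatingMonoid β α := by
  intro x y
  refine ⟨hf x y, fun h => ?_⟩
  have hs : Function.Surjective f := Finite.injective_iff_surjective.1 hfi
  let g : β → β := fun b => (f (b, x.2)).1
  have hg : Function.Surjective g := fun b => by
    obtain ⟨z, hz⟩ := hs (b, x.2)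
    exact ⟨z.1, (hf (z.1, x.2) z rfl).trans (congrArg Prod.fst hz)⟩
  apply Finite.injective_iff_surjective.2 hg
  exact (hf (x.1, x.2) x rfl).trans (h.trans (hf y (y.1, x.2) rfl))

/-- The transformation of `β × α` acting by a transformation on the first coordinate. -/
def topEnd : Function.End β →* Function.End (β × α) where
  toFun g := fun x => (g x.1, x.2)
  map_one' := rfl
  map_mul' _ _ := rfl

/-- The transformation of `β × α` acting by a transformation on each fibre. -/
def baseEnd : (β → Function.End α) →* Function.End (β × α) where
  toFun F := fun x => (x.1, F x.1 x.2)
  map_one' := rfl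
  map_mul' _ _ := rfl

theorem baseEnd_apply (F : β → Function.End α) (x : β × α) :
    baseEnd F x = (x.1, F x.1 x.2) := rfl

/-- The first coordinate of the value depends only on the fibre, so it can be read off at any
reference point. -/
theorem exists_eq_topEnd_mul_baseEnd [Nonempty α] {f : Function.End (β × α)}
    (hf : f ∈ fibreMonoid β α) : ∃ g F, f = topEnd g * baseEnd F := by
  obtain ⟨a⟩ := ‹Nonempty α›
  exact ⟨fun b => (f (b, a)).1, fun b c => (f (b, c)).2,
    funext fun x => Prod.ext (hf x (x.1, a) rfl) rfl⟩

theorem topEnd_mem_fibreInjectiveMonoid (g : Function.End β) :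
    topEnd g ∈ fibreInjectiveMonoid β α :=
  ⟨fun _ _ h => congrArg g h, fun _ _ h h' => Prod.ext h (Prod.ext_iff.1 h').2⟩

theorem baseEnd_mem_fibreSeparatingMonoid (F : β → Function.End α) :
    baseEnd F ∈ fibreSeparatingMonoid β α := fun _ _ => Iff.rfl

theorem injective_of_topEnd_mul_baseEnd_separating [Nonempty α] {g : Function.End β}
    {F : β → Function.End α} (h : topEnd g * baseEnd F ∈ fibreSeparatingMonoid β α) :
    Function.Injective g := by
  obtain ⟨a⟩ := ‹Nonempty α›
  exact fun b c hbc => (h (b, a) (c, a)).2 hbc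

theorem injective_of_topEnd_mul_baseEnd_fibreInjective {g : Function.End β}
    {F : β → Function.End α} (h : topEnd g * baseEnd F ∈ fibreInjectiveMonoid β α) (b : β) :
    Function.Injective (F b) := fun a c hac =>
  congrArg Prod.snd (h.2 (b, a) (b, c) rfl (Prod.ext rfl hac))

theorem not_injective_topEnd [Nonempty α] {g : Function.End β} (h : ¬ Function.Injective g) :
    ¬ Function.Injective (topEnd g : Function.End (β × α)) := by
  obtain ⟨a⟩ := ‹Nonempty α›
  exact fun hi => h fun b c hbc => congrArg Prod.fst (@hi (b, a) (c, a) (Prod.ext hbc rfl))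

section Generation

variable [DecidableEq β]

theorem not_injective_baseEnd_mulSingle {b : β} {f : Function.End α}
    (h : ¬ Function.Injective f) :
    ¬ Function.Injective (baseEnd (Pi.mulSingle b f) : Function.End (β × α)) := fun hi =>
  h fun a c hac => congrArg Prod.snd
    (@hi (b, a) (b, c) (by simp only [baseEnd_apply, Pi.mulSingle_eq_same, hac]))

theorem permEnd_basePerm_mulSingle (b : β) (σ : Perm α) :
    permEnd (basePerm (Pi.mulSingle b σ)) = baseEnd (Pi.mulSingle b (permEnd σ)) := by
  funext x
  refine Prod.ext rfl ?_
  change (Pi.mulSingle b σ : β → Perm α) x.1 x.2 =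
    (Pi.mulSingle b (permEnd σ) : β → Function.End α) x.1 x.2
  by_cases h : x.1 = b
  · rw [h, Pi.mulSingle_eq_same, Pi.mulSingle_eq_same]; rfl
  · rw [Pi.mulSingle_eq_of_ne h, Pi.mulSingle_eq_of_ne h]; rfl

variable [Finite β] {S : Submonoid (Function.End (β × α))}

theorem topEnd_mem (htop : ∀ σ, permEnd (topPerm σ) ∈ S) {b c : β} (hbc : b ≠ c)
    (hcol : topEnd (collapse b c) ∈ S) (g : Function.End β) : topEnd g ∈ S := by
  have : S.comap topEnd = ⊤ := eq_top_of_permEnd_mem (fun σ => htop σ) hbc hcol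
  exact this.ge (Submonoid.mem_top g)

/-- Maps acting on different fibres multiply to `F`, and there are finitely many fibres. -/
theorem baseEnd_mem_of_mulSingle {F : β → Function.End α}
    (h : ∀ b, baseEnd (Pi.mulSingle b (F b)) ∈ S) : baseEnd F ∈ S :=
  Submonoid.pi_mem_of_mulSingle_mem (H := S.comap baseEnd) F h

theorem baseEnd_mem_of_injective [Finite α]
    (hbase : ∀ b σ, permEnd (basePerm (Pi.mulSingle b σ)) ∈ S) {F : β → Function.End α}
    (hF : ∀ b, Function.Injective (F b)) : baseEnd F ∈ S := by
  refine baseEnd_mem_of_mulSingle fun b => ?_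
  obtain ⟨σ, hσ⟩ := exists_permEnd_eq (hF b)
  rw [← hσ, ← permEnd_basePerm_mulSingle]
  exact hbase b σ

theorem baseEnd_mem [Finite α] [DecidableEq α] (htop : ∀ σ, permEnd (topPerm σ) ∈ S)
    (hbase : ∀ b σ, permEnd (basePerm (Pi.mulSingle b σ)) ∈ S) {b : β} {a c : α} (hac : a ≠ c)
    (hcol : baseEnd (Pi.mulSingle b (collapse a c)) ∈ S) (F : β → Function.End α) :
    baseEnd F ∈ S := by
  refine baseEnd_mem_of_mulSingle fun d => ?_
  have hcol' : baseEnd (Pi.mulSingle d (collapse a c)) ∈ S := by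
    -- Conjugation by a swap of blocks moves the collapse from block `b` to block `d`.
    have : baseEnd (Pi.mulSingle d (collapse a c)) = permEnd (topPerm (swap b d)) *
        baseEnd (Pi.mulSingle b (collapse a c)) * permEnd (topPerm (swap b d)) := by
      funext x
      refine Prod.ext (swap_apply_self b d x.1).symm ?_
      change (Pi.mulSingle d (collapse a c) : β → Function.End α) x.1 x.2 =
        (Pi.mulSingle b (collapse a c) : β → Function.End α) (swap b d x.1) x.2
      simp only [Pi.mulSingle_apply, swap_apply_eq_iff, swap_apply_left]
    rw [this]
    exact mul_mem (mul_mem (htop _) hcol) (htop _)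
  have : S.comap (baseEnd.comp (MonoidHom.mulSingle (fun _ : β => Function.End α) d)) = ⊤ := by
    refine eq_top_of_permEnd_mem (fun σ => ?_) hac hcol'
    have := hbase d σ
    rwa [permEnd_basePerm_mulSingle] at this
  exact this.ge (Submonoid.mem_top (F d))

end Generation

end Fibres

/-! ### Generating sets -/

section Rank

variable (m n : ℕ)

theorem exists_generators :
    (∃ U : Finset (Function.End (Fin (m + 2) × Fin (n + 2))), U.card ≤ 4 ∧
      Submonoid.closure (U : Set (Function.End (Fin (m + 2) × Fin (n + 2)))) =
        fibreMonoid _ _) ∧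
    (∃ U : Finset (Function.End (Fin (m + 2) × Fin (n + 2))), U.card ≤ 3 ∧
      Submonoid.closure (U : Set (Function.End (Fin (m + 2) × Fin (n + 2)))) =
        fibreSeparatingMonoid _ _) ∧
    (∃ U : Finset (Function.End (Fin (m + 2) × Fin (n + 2))), U.card ≤ 3 ∧
      Submonoid.closure (U : Set (Function.End (Fin (m + 2) × Fin (n + 2)))) =
        fibreInjectiveMonoid _ _) := by
  classical
  obtain ⟨x, y, hxy, htop, hbase⟩ := exists_wreath_generators m n
  have htop' {S : Submonoid (Function.End (Fin (m + 2) × Fin (n + 2)))} (hx : permEnd x ∈ S)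
      (hy : permEnd y ∈ S) (σ) : permEnd (topPerm σ) ∈ S := permEnd_mem_closure (htop σ) hx hy
  have hbase' {S : Submonoid (Function.End (Fin (m + 2) × Fin (n + 2)))} (hx : permEnd x ∈ S)
      (hy : permEnd y ∈ S) (b σ) : permEnd (basePerm (Pi.mulSingle b σ)) ∈ S :=
    permEnd_mem_closure (hbase b σ) hx hy
  have hsep : ∀ z ∈ ({x, y} : Set (Perm (Fin (m + 2) × Fin (n + 2)))),
      permEnd z ∈ fibreSeparatingMonoid _ _ := fun z hz u v => (hxy z hz u v).symm
  have hinj : ∀ z ∈ ({x, y} : Set (Perm (Fin (m + 2) × Fin (n + 2)))),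
      permEnd z ∈ fibreInjectiveMonoid _ _ := fun z hz =>
    ⟨mem_fibreMonoid_of_separating (hsep z hz), fun _ _ _ h => z.injective h⟩
  have h01 {k : ℕ} : (0 : Fin (k + 2)) ≠ 1 := zero_ne_one
  let t : Function.End (Fin (m + 2) × Fin (n + 2)) := topEnd (collapse 0 1)
  let e : Function.End (Fin (m + 2) × Fin (n + 2)) := baseEnd (Pi.mulSingle 0 (collapse 0 1))
  have ht : t ∈ fibreInjectiveMonoid _ _ := topEnd_mem_fibreInjectiveMonoid _
  have he : e ∈ fibreSeparatingMonoid _ _ := baseEnd_mem_fibreSeparatingMonoid _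
  refine ⟨⟨{permEnd x, permEnd y, e, t}, Finset.card_le_four, le_antisymm ?_ fun f hf => ?_⟩,
    ⟨{permEnd x, permEnd y, e}, Finset.card_le_three, le_antisymm ?_ fun f hf => ?_⟩,
    ⟨{permEnd x, permEnd y, t}, Finset.card_le_three, le_antisymm ?_ fun f hf => ?_⟩⟩
  · rw [Submonoid.closure_le]
    intro z hz
    simp only [Finset.coe_insert, Finset.coe_singleton, Set.mem_insert_iff,
      Set.mem_singleton_iff] at hz
    rcases hz with rfl | rfl | rfl | rfl
    · exact (hinj x (by simp)).1
    · exact (hinj y (by simp)).1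
    · exact mem_fibreMonoid_of_separating he
    · exact ht.1
  · have hx := Submonoid.subset_closure (s := (({permEnd x, permEnd y, e, t} : Finset _) :
      Set (Function.End (Fin (m + 2) × Fin (n + 2))))) (show permEnd x ∈ _ by simp)
    have hy := Submonoid.subset_closure (s := (({permEnd x, permEnd y, e, t} : Finset _) :
      Set (Function.End (Fin (m + 2) × Fin (n + 2))))) (show permEnd y ∈ _ by simp)
    obtain ⟨g, F, rfl⟩ := exists_eq_topEnd_mul_baseEnd hf
    exact mul_mem (topEnd_mem (htop' hx hy) h01 (Submonoid.subset_closure (by simp [t])) g)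
      (baseEnd_mem (htop' hx hy) (hbase' hx hy) (b := 0) h01
        (Submonoid.subset_closure (by simp [e])) F)
  · rw [Submonoid.closure_le]
    intro z hz
    simp only [Finset.coe_insert, Finset.coe_singleton, Set.mem_insert_iff,
      Set.mem_singleton_iff] at hz
    rcases hz with rfl | rfl | rfl
    · exact hsep x (by simp)
    · exact hsep y (by simp)
    · exact he
  · have hx := Submonoid.subset_closure (s := (({permEnd x, permEnd y, e} : Finset _) :
      Set (Function.End (Fin (m + 2) × Fin (n + 2))))) (show permEnd x ∈ _ by simp)
    have hy := Submonoid.subset_closure (s := (({permEnd x, permEnd y, e} : Finset _) :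
      Set (Function.End (Fin (m + 2) × Fin (n + 2))))) (show permEnd y ∈ _ by simp)
    obtain ⟨g, F, rfl⟩ := exists_eq_topEnd_mul_baseEnd (mem_fibreMonoid_of_separating hf)
    obtain ⟨σ, rfl⟩ := exists_permEnd_eq (injective_of_topEnd_mul_baseEnd_separating hf)
    exact mul_mem (htop' hx hy σ) (baseEnd_mem (htop' hx hy) (hbase' hx hy) (b := 0) h01
        (Submonoid.subset_closure (by simp [e])) F)
  · rw [Submonoid.closure_le]
    intro z hz
    simp only [Finset.coe_insert, Finset.coe_singleton, Set.mem_insert_iff,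
      Set.mem_singleton_iff] at hz
    rcases hz with rfl | rfl | rfl
    · exact hinj x (by simp)
    · exact hinj y (by simp)
    · exact ht
  · have hx := Submonoid.subset_closure (s := (({permEnd x, permEnd y, t} : Finset _) :
      Set (Function.End (Fin (m + 2) × Fin (n + 2))))) (show permEnd x ∈ _ by simp)
    have hy := Submonoid.subset_closure (s := (({permEnd x, permEnd y, t} : Finset _) :
      Set (Function.End (Fin (m + 2) × Fin (n + 2))))) (show permEnd y ∈ _ by simp)
    obtain ⟨g, F, rfl⟩ := exists_eq_topEnd_mul_baseEnd hf.1
    exact mul_mem (topEnd_mem (htop' hx hy) h01 (Submonoid.subset_closure (by simp [t])) g)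
      (baseEnd_mem_of_injective (hbase' hx hy)
        (injective_of_topEnd_mul_baseEnd_fibreInjective hf))

variable {m n} {U : Finset (Function.End (Fin (m + 2) × Fin (n + 2)))}

/-- A generating set of one of the monoids contains at least two permutations. -/
theorem two_le_card_filter_of_le
    [DecidablePred (· ∈ injectiveEnd (Fin (m + 2) × Fin (n + 2)))]
    (hsub : fibreSeparatingMonoid _ _ ⊓ fibreInjectiveMonoid _ _ ≤
      Submonoid.closure (U : Set (Function.End (Fin (m + 2) × Fin (n + 2))))) :
    2 ≤ (U.filter (· ∈ injectiveEnd _)).card := by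
  classical
  let u : Perm (Fin (m + 2) × Fin (n + 2)) := topPerm (swap 0 1)
  let v : Perm (Fin (m + 2) × Fin (n + 2)) := basePerm (Pi.mulSingle 0 (swap 0 1))
  have hmem (z : Perm (Fin (m + 2) × Fin (n + 2))) (hz : permEnd z ∈ fibreSeparatingMonoid _ _) :
      permEnd z ∈ Submonoid.closure (U : Set (Function.End (Fin (m + 2) × Fin (n + 2)))) :=
    hsub ⟨hz, mem_fibreMonoid_of_separating hz, fun _ _ _ h => z.injective h⟩
  refine two_le_card_filter_injective (hmem u fun a b => ?_) u.injective
    (hmem v fun a b => Iff.rfl) v.injective ?_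
  · exact (swap (0 : Fin (m + 2)) 1).injective.eq_iff.symm
  · intro h
    -- At `(0, 0)` the two orders give second coordinates `1` and `0`.
    have h' := congrArg Prod.snd (congrFun h (0, 0))
    change (basePerm (Pi.mulSingle 0 (swap 0 1)) ((0, 0) : Fin (m + 2) × Fin (n + 2))).2 =
      (basePerm (Pi.mulSingle 0 (swap 0 1))
        (swap (0 : Fin (m + 2)) 1 0, (0 : Fin (n + 2)))).2 at h'
    rw [swap_apply_left, basePerm_apply, basePerm_apply, Pi.mulSingle_eq_same,
      Pi.mulSingle_eq_of_ne one_ne_zero] at h'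
    simp at h'

/-- If all separating generators were injective, so would be all separating products: when `f * g`
separates fibres, so does `g`; once `g` is bijective, so does `f`. A collapse inside one block
contradicts this. -/
theorem exists_separating_not_injective_mem
    (hU : Submonoid.closure (U : Set (Function.End (Fin (m + 2) × Fin (n + 2)))) ≤
      fibreMonoid _ _)
    (hsub : fibreSeparatingMonoid _ _ ≤
      Submonoid.closure (U : Set (Function.End (Fin (m + 2) × Fin (n + 2))))) :
    ∃ f ∈ U, f ∈ fibreSeparatingMonoid _ _ ∧ ¬ Function.Injective f := by
  by_contra! hcon
  have key : ∀ f ∈ Submonoid.closure (U : Set (Function.End (Fin (m + 2) × Fin (n + 2)))),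
      f ∈ fibreSeparatingMonoid _ _ → Function.Injective f := by
    intro f hf
    induction hf using Submonoid.closure_induction with
    | mem f hf => exact hcon f hf
    | one => exact fun _ => Function.injective_id
    | mul f g hf hg ihf ihg =>
      intro hfg
      have hgs : g ∈ fibreSeparatingMonoid _ _ := fun a b =>
        ⟨hU hg a b, fun h => (hfg a b).2 (hU hf _ _ h)⟩
      have hgi := ihg hgs
      refine (ihf fun a b => ⟨hU hf a b, fun h => ?_⟩).comp hgi
      obtain ⟨a, rfl⟩ := Finite.injective_iff_surjective.1 hgi a
      obtain ⟨b, rfl⟩ := Finite.injective_iff_surjective.1 hgi b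
      exact hU hg _ _ ((hfg a b).2 h)
  have hmem := baseEnd_mem_fibreSeparatingMonoid (β := Fin (m + 2)) (α := Fin (n + 2))
    (Pi.mulSingle 0 (collapse 0 1))
  exact not_injective_baseEnd_mulSingle (collapse_not_injective zero_ne_one)
    (key _ (hsub hmem) hmem)

/-- The same divisibility argument: `g` inherits injectivity on fibres from `f * g`, and a bijective
`g` permutes the fibres, so `f` inherits it too. A collapse of one block onto another gives the
contradiction. -/
theorem exists_fibreInjective_not_injective_mem
    (hU : Submonoid.closure (U : Set (Function.End (Fin (m + 2) × Fin (n + 2)))) ≤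
      fibreMonoid _ _)
    (hsub : fibreInjectiveMonoid _ _ ≤
      Submonoid.closure (U : Set (Function.End (Fin (m + 2) × Fin (n + 2))))) :
    ∃ f ∈ U, f ∈ fibreInjectiveMonoid _ _ ∧ ¬ Function.Injective f := by
  by_contra! hcon
  have key : ∀ f ∈ Submonoid.closure (U : Set (Function.End (Fin (m + 2) × Fin (n + 2)))),
      f ∈ fibreInjectiveMonoid _ _ → Function.Injective f := by
    intro f hf
    induction hf using Submonoid.closure_induction with
    | mem f hf => exact hcon f hf
    | one => exact fun _ => Function.injective_id
    | mul f g hf hg ihf ihg =>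
      intro hfg
      have hgi := ihg ⟨hU hg, fun a b hab h => hfg.2 a b hab (congrArg f h)⟩
      have hgs := fibreSeparating_of_injective (hU hg) hgi
      refine (ihf ⟨hU hf, fun a b hab h => ?_⟩).comp hgi
      obtain ⟨a, rfl⟩ := Finite.injective_iff_surjective.1 hgi a
      obtain ⟨b, rfl⟩ := Finite.injective_iff_surjective.1 hgi b
      exact congrArg g (hfg.2 a b ((hgs a b).2 hab) h)
  have hmem := topEnd_mem_fibreInjectiveMonoid (α := Fin (n + 2))
    (collapse (0 : Fin (m + 2)) 1)
  exact not_injective_topEnd (collapse_not_injective zero_ne_one) (key _ (hsub hmem) hmem)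

theorem three_le_card_of_not_injective_mem
    (hsub : fibreSeparatingMonoid _ _ ⊓ fibreInjectiveMonoid _ _ ≤
      Submonoid.closure (U : Set (Function.End (Fin (m + 2) × Fin (n + 2)))))
    {f : Function.End (Fin (m + 2) × Fin (n + 2))} (hf : f ∈ U) (hfi : ¬ Function.Injective f) :
    3 ≤ U.card := by
  classical
  have h1 := two_le_card_filter_of_le hsub
  have h2 : 0 < (U.filter (· ∉ injectiveEnd _)).card :=
    Finset.card_pos.2 ⟨f, Finset.mem_filter.2 ⟨hf, hfi⟩⟩
  have h3 := Finset.card_filter_add_card_filter_not (s := U)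
    (· ∈ injectiveEnd _)
  omega

theorem three_le_card_of_closure_eq_separating
    (hU : Submonoid.closure (U : Set (Function.End (Fin (m + 2) × Fin (n + 2)))) =
      fibreSeparatingMonoid _ _) : 3 ≤ U.card := by
  obtain ⟨f, hf, -, hfi⟩ := exists_separating_not_injective_mem
    (hU.le.trans fun _ => mem_fibreMonoid_of_separating) hU.ge
  exact three_le_card_of_not_injective_mem (inf_le_left.trans hU.ge) hf hfi

theorem three_le_card_of_closure_eq_fibreInjective
    (hU : Submonoid.closure (U : Set (Function.End (Fin (m + 2) × Fin (n + 2)))) =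
      fibreInjectiveMonoid _ _) : 3 ≤ U.card := by
  obtain ⟨f, hf, -, hfi⟩ := exists_fibreInjective_not_injective_mem
    (hU.le.trans fun _ h => h.1) hU.ge
  exact three_le_card_of_not_injective_mem (inf_le_right.trans hU.ge) hf hfi

theorem four_le_card_of_closure_eq_fibreMonoid
    (hU : Submonoid.closure (U : Set (Function.End (Fin (m + 2) × Fin (n + 2)))) =
      fibreMonoid _ _) : 4 ≤ U.card := by
  classical
  have hle : fibreSeparatingMonoid _ _ ≤
      Submonoid.closure (U : Set (Function.End (Fin (m + 2) × Fin (n + 2)))) :=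
    le_trans (fun _ => mem_fibreMonoid_of_separating) hU.ge
  have h1 := two_le_card_filter_of_le (inf_le_left.trans hle)
  obtain ⟨f, hf, hfs, hfi⟩ := exists_separating_not_injective_mem hU.le hle
  obtain ⟨g, hg, hgs, hgi⟩ := exists_fibreInjective_not_injective_mem hU.le
    (le_trans (fun _ h => h.1) hU.ge)
  have hfg : f ≠ g := by
    rintro rfl
    exact hfi (injective_of_separating_of_fibreInjective hfs hgs)
  have h2 : 1 < (U.filter (· ∉ injectiveEnd _)).card :=
    Finset.one_lt_card.2 ⟨f, Finset.mem_filter.2 ⟨hf, hfi⟩, g, Finset.mem_filter.2 ⟨hg, hgi⟩, hfg⟩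
  have h3 := Finset.card_filter_add_card_filter_not (s := U)
    (· ∈ injectiveEnd _)
  omega

end Rank

/-! ### Uniform partitions -/

section Partition

variable {X : Type*} {P : Set (Set X)}

theorem block_eq_of_mem (hP : Setoid.IsPartition P) {B C : Set X} (hB : B ∈ P) (hC : C ∈ P)
    {x : X} (hxB : x ∈ B) (hxC : x ∈ C) : B = C :=
  (hP.2 x).unique ⟨hB, hxB⟩ ⟨hC, hxC⟩

/-- A non-trivial uniform partition is the partition of a product into the fibres of the first
projection. -/
theorem exists_equiv_prod [Finite X] (hX : 3 ≤ Nat.card X) (hP : Setoid.IsPartition P)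
    (hunif : IsUniformFamily P) (hnontriv : IsNontrivialFamily P) :
    ∃ (m n : ℕ) (e : X ≃ Fin (m + 2) × Fin (n + 2)),
      ∀ x y, SameBlock P x y ↔ (e x).1 = (e y).1 := by
  have : Nonempty X := (Nat.card_pos_iff.1 (by omega)).1
  choose b hb using fun x => (hP.2 x).exists
  let π : X → P := fun x => ⟨b x, (hb x).1⟩
  have hπ (x : X) (B : P) : π x = B ↔ x ∈ (B : Set X) :=
    ⟨fun h => h ▸ (hb x).2, fun h => Subtype.ext (block_eq_of_mem hP (hb x).1 B.2 (hb x).2 h)⟩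
  obtain ⟨x₀⟩ := this
  obtain ⟨n, hn⟩ : ∃ n, n = (b x₀).ncard := ⟨_, rfl⟩
  have hcard (B : P) : Nat.card {x // π x = B} = n := by
    rw [hn, hunif _ (hb x₀).1 B B.2, ← Nat.card_coe_set_eq]
    exact Nat.card_congr (Equiv.subtypeEquivRight fun x => hπ x B)
  obtain ⟨m, hm⟩ : ∃ m, m = Nat.card P := ⟨_, rfl⟩
  let eP : P ≃ Fin m := Finite.equivFinOfCardEq hm.symm
  -- The numbering within each block is arbitrary; only the first coordinate, which names the block,
  -- is used.
  let e : X ≃ Fin m × Fin n :=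
    (Equiv.sigmaFiberEquiv π).symm.trans
      ((Equiv.sigmaCongrRight fun B => Finite.equivFinOfCardEq (hcard B)).trans
        ((Equiv.sigmaEquivProd P (Fin n)).trans (Equiv.prodCongr eP (Equiv.refl _))))
  have he (x : X) : (e x).1 = eP (π x) := rfl
  have hmn : Nat.card X = m * n := by rw [Nat.card_congr e]; simp
  have hm1 : m ≠ 1 := by rw [hm, Nat.card_coe_set_eq]; exact hnontriv.1
  have hn1 : n ≠ 1 := by
    rintro rfl
    rw [mul_one, hm, Nat.card_coe_set_eq] at hmn
    exact hnontriv.2 hmn.symm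
  have hm0 : m ≠ 0 := by rintro rfl; omega
  have hn0 : n ≠ 0 := by rintro rfl; omega
  obtain ⟨m, rfl⟩ : ∃ k, m = k + 2 := ⟨m - 2, by omega⟩
  obtain ⟨n, rfl⟩ : ∃ k, n = k + 2 := ⟨n - 2, by omega⟩
  refine ⟨m, n, e, fun x y => ?_⟩
  rw [he, he, eP.injective.eq_iff]
  constructor
  · rintro ⟨B, hB, hx, hy⟩
    exact ((hπ x ⟨B, hB⟩).2 hx).trans ((hπ y ⟨B, hB⟩).2 hy).symm
  · intro h
    exact ⟨b x, (hb x).1, (hb x).2, (hπ y (π x)).1 h.symm⟩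

theorem mem_transPreserving_iff (hP : Setoid.IsPartition P) {f : Function.End X} :
    f ∈ transPreserving P ↔ ∀ x y, SameBlock P x y → SameBlock P (f x) (f y) := by
  constructor
  · rintro hf x y ⟨B, hB, hx, hy⟩
    obtain ⟨C, hC, hBC⟩ := hf B hB
    exact ⟨C, hC, hBC ⟨x, hx, rfl⟩, hBC ⟨y, hy, rfl⟩⟩
  · intro hf B hB
    obtain ⟨x, hx⟩ := Setoid.nonempty_of_mem_partition hP hB
    obtain ⟨C, ⟨hC, hxC⟩, -⟩ := hP.2 (f x)
    refine ⟨C, hC, ?_⟩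
    rintro _ ⟨y, hy, rfl⟩
    obtain ⟨D, hD, hxD, hyD⟩ := hf x y ⟨B, hB, hx, hy⟩
    rwa [block_eq_of_mem hP hC hD hxC hxD]

/-- A map from a block into a block of the same finite size is onto exactly when it is injective. -/
theorem mem_gammaMonoid_iff [Finite X] (hP : Setoid.IsPartition P) (hunif : IsUniformFamily P)
    {f : Function.End X} :
    f ∈ gammaMonoid P hP ↔ f ∈ transPreserving P ∧
      ∀ x y, SameBlock P x y → f x = f y → x = y := by
  refine and_congr_right fun hf => ⟨?_, ?_⟩
  · rintro h x y ⟨B, hB, hx, hy⟩ hxy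
    obtain ⟨C, hC, hBC⟩ := hf B hB
    have himg : (f : X → X) '' B = C := by
      refine (h B hB C hC).resolve_left fun hemp => ?_
      exact Set.notMem_empty (f x) (hemp ▸ ⟨⟨x, hx, rfl⟩, hBC ⟨x, hx, rfl⟩⟩)
    have hinj : Set.InjOn (f : X → X) B :=
      Set.injOn_of_ncard_image_eq ((congrArg Set.ncard himg).trans (hunif C hC B hB))
    exact hinj hx hy hxy
  · intro h B hB C hC
    obtain ⟨D, hD, hBD⟩ := hf B hB
    have himg : (f : X → X) '' B = D := by
      refine Set.eq_of_subset_of_ncard_le hBD ?_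
      have hinj : Set.InjOn (f : X → X) B := fun x hx y hy hxy => h x y ⟨B, hB, hx, hy⟩ hxy
      exact ((hunif D hD B hB).trans hinj.ncard_image.symm).le
    rw [himg]
    by_cases hDC : D = C
    · exact Or.inr hDC
    · exact Or.inl (Set.disjoint_iff_inter_eq_empty.1 (hP.pairwiseDisjoint hD hC hDC))

end Partition

theorem theorem1p1 {X : Type*} [Finite X] (hX : 3 ≤ Nat.card X)
    (P : Set (Set X)) (hP : Setoid.IsPartition P)
    (hunif : IsUniformFamily P) (hnontriv : IsNontrivialFamily P) :
    monoidRank (transPreserving P) = 4 ∧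
      monoidRank (sigmaMonoid P) = 3 ∧
      monoidRank (gammaMonoid P hP) = 3 := by
  obtain ⟨m, n, e, he⟩ := exists_equiv_prod hX hP hunif hnontriv
  obtain ⟨hT, hS, hG⟩ := exists_generators m n
  have hconj (f : Function.End X) (x : X) : conjEnd e f (e x) = e (f x) := by
    rw [conjEnd_apply, e.symm_apply_apply]
  have hmem (f : Function.End X) : f ∈ transPreserving P ↔ conjEnd e f ∈ fibreMonoid _ _ := by
    rw [mem_transPreserving_iff hP]
    change _ ↔ ∀ x y, _
    simp only [← e.forall_congr_right (q := fun _ => _), hconj, he]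
  refine ⟨monoidRank_submonoid_eq e hmem hT fun U => four_le_card_of_closure_eq_fibreMonoid,
    monoidRank_submonoid_eq e (fun f => ?_) hS fun U => three_le_card_of_closure_eq_separating,
    monoidRank_submonoid_eq e (fun f => ?_) hG
      fun U => three_le_card_of_closure_eq_fibreInjective⟩
  · change (∀ x y, _) ↔ ∀ x y, _
    simp only [← e.forall_congr_right (q := fun _ => _), hconj, he]
  · rw [mem_gammaMonoid_iff hP hunif, hmem]
    refine and_congr_right fun _ => ?_
    simp only [← e.forall_congr_right (q := fun _ => _), hconj, he, e.injective.eq_iff]
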